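/- Let $\ell$ be a prime. An oriented pro-$\ell$ group is a pair $(G,\theta)$ consisting of a pro-$\ell$ group $G$ and a continuous homomorphism $\theta\colon G\to\mathbb{Z}_\ell^\times$; a homomorphism $\phi\colon(G,\theta)\to(H,\theta')$ of oriented pro-$\ell$ groups is a continuous group homomorphism $\phi\colon G\to H$ with $\theta'\circ\phi=\theta$. Write $\Phi(G)=\mathrm{cl}(G^\ell\cdot[G,G])$ for the Frattini subgroup of $G$, and $\mathbb{Z}_\ell(1)$ for the $G$-module $\mathbb{Z}_\ell$ on which $g\in G$ acts as multiplication by $\theta(g)$. Let $K_\theta(G)$ be the closed subgroup of $G$ generated by all elements $h^{-\theta(g)}ghg^{-1}$ with $g\in G$, $h\in\ker(\theta)$, let $I_\theta(G)$ be the closed subgroup generated by all $g\in\ker(\theta)$ with $g^{\ell^k}\in K_\theta(G)$ for some $k\ge 0$, and let $G(\theta)=G/I_\theta(G)$ (the maximal $\theta$-abelian quotient). The oriented pro-$\ell$ group $(G,\theta)$ is called Kummerian if - it is torsion-free, i.e. $\ell\neq 2$, or $\ell=2$ and $\mathrm{im}(\theta)\subseteq 1+4\mathbb{Z}_2$; and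 - for every $n\ge 1$ the map $H^1(G,\mathbb{Z}_\ell(1)/\ell^n)\to H^1(G,\mathbb{Z}_\ell(1)/\ell)=H^1(G,\mathbb{F}_\ell)$ on continuous cohomology induced by reduction of coefficients is surjective. **Corollary 3.10.** Let $(G,\theta)$ and $(H,\theta')$ be Kummerian oriented pro-$\ell$ groups, and let $\phi\colon(G,\theta)\to(H,\theta')$ be a homomorphism of oriented pro-$\ell$ groups such that the induced map $\phi_*\colon G/\Phi(G)\to H/\Phi(H)$ is injective. Then the induced homomorphism $\phi^{\mathrm{ab}}\colon G(\theta)\to H(\theta')$, $g\,I_\theta(G)\mapsto\phi(g)\,I_{\theta'}(H)$, is injective. -/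

import Mathlib

open Filter Topology

namespace OrientedProL

universe u v

/-! ### Pro-`ℓ` groups and `ℓ`-adic powers -/

/-- A profinite group is a pro-`ℓ` group if all its open normal subgroups have index a power
of `ℓ`. (That the topological group is profinite, i.e. compact, Hausdorff and totally
disconnected, is expressed by Mathlib's type classes.) -/
class IsProL (ℓ : ℕ) (G : Type u) [Group G] [TopologicalSpace G] : Prop where
  index_eq_pow : ∀ N : Subgroup G, N.Normal → IsOpen (N : Set G) → ∃ k : ℕ, N.index = ℓ ^ k

/-- The power `h ^ x` with `ℓ`-adic exponent `x`: the limit of the powers `h ^ n`, where the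
natural number `n` tends `ℓ`-adically to `x`. The limit exists in every pro-`ℓ` group, see
`tendsto_padicPow`. -/
noncomputable def padicPow {ℓ : ℕ} [Fact ℓ.Prime] {G : Type u} [Group G] [TopologicalSpace G]
    (h : G) (x : ℤ_[ℓ]) : G :=
  limUnder (comap (Nat.cast : ℕ → ℤ_[ℓ]) (𝓝 x)) (fun n : ℕ => h ^ n)

instance comap_natCast_neBot {ℓ : ℕ} [Fact ℓ.Prime] (x : ℤ_[ℓ]) :
    (comap (Nat.cast : ℕ → ℤ_[ℓ]) (𝓝 x)).NeBot :=
  comap_neBot_iff.2 fun _ ht =>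
    let ⟨_, hy, n, hn⟩ := mem_closure_iff_nhds.1 (PadicInt.denseRange_natCast (p := ℓ) x) _ ht
    ⟨n, hn ▸ hy⟩

theorem exists_tendsto_pow {ℓ : ℕ} [Fact ℓ.Prime] {G : Type u} [Group G] [TopologicalSpace G]
    [IsTopologicalGroup G] [CompactSpace G] [T2Space G] [TotallyDisconnectedSpace G] [IsProL ℓ G]
    (h : G) (x : ℤ_[ℓ]) :
    ∃ y : G, Tendsto (fun n : ℕ => h ^ n) (comap (Nat.cast : ℕ → ℤ_[ℓ]) (𝓝 x)) (𝓝 y) := by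
  set l := map (fun n : ℕ => h ^ n) (comap (Nat.cast : ℕ → ℤ_[ℓ]) (𝓝 x)) with hl
  have : l.NeBot := by rw [hl]; infer_instance
  obtain ⟨y, hy⟩ := exists_clusterPt_of_compactSpace l
  refine ⟨y, le_nhds_of_unique_clusterPt fun z hz => ?_⟩
  by_contra hne
  have h1 : (1 : G) ∈ ({z⁻¹ * y}ᶜ : Set G) := by
    intro h0
    apply hne
    have h0' : (1 : G) = z⁻¹ * y := h0
    calc z = z * 1 := (mul_one z).symm
      _ = z * (z⁻¹ * y) := by rw [← h0']
      _ = y := by group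
  obtain ⟨N, hN⟩ := ProfiniteGrp.exist_openNormalSubgroup_sub_open_nhds_of_one
    (isOpen_compl_singleton (x := z⁻¹ * y)) h1
  obtain ⟨k, hk⟩ := IsProL.index_eq_pow (ℓ := ℓ) (N.toSubgroup) N.isNormal' N.isOpen'
  -- all powers of `h` with exponents close to `x` lie in one coset of `N`
  have hball : {w : ℤ_[ℓ] | (ℓ : ℤ_[ℓ]) ^ k ∣ w - x} ∈ 𝓝 x := by
    refine mem_of_superset (Metric.ball_mem_nhds x
      (ε := (ℓ : ℝ) ^ (-(k : ℤ))) (by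
        have : 0 < ℓ := (Fact.out : ℓ.Prime).pos
        positivity)) ?_
    intro w hw
    have hw' : ‖w - x‖ < (ℓ : ℝ) ^ (-(k : ℤ)) := by simpa [dist_eq_norm] using hw
    have := (PadicInt.norm_le_pow_iff_mem_span_pow (w - x) k).1 hw'.le
    exact Ideal.mem_span_singleton.1 this
  obtain ⟨m, hm⟩ := ((inferInstance :
    (comap (Nat.cast : ℕ → ℤ_[ℓ]) (𝓝 x)).NeBot).nonempty_of_mem (preimage_mem_comap hball))
  have hpow : ∀ n : ℕ, (ℓ : ℤ_[ℓ]) ^ k ∣ (n : ℤ_[ℓ]) - x → (h ^ m)⁻¹ * h ^ n ∈ N.toSubgroup := by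
    intro n hn
    have hd : (ℓ : ℤ_[ℓ]) ^ k ∣ (((n : ℤ) - (m : ℤ) : ℤ) : ℤ_[ℓ]) := by
      have := dvd_sub hn hm
      push_cast
      simpa using this
    have hd' : ((ℓ ^ k : ℕ) : ℤ) ∣ (n : ℤ) - (m : ℤ) := by
      have := (PadicInt.pow_p_dvd_int_iff k ((n : ℤ) - (m : ℤ))).1 hd
      simpa using this
    obtain ⟨c, hc⟩ := hd'
    have : (h ^ m)⁻¹ * h ^ n = (h ^ (ℓ ^ k)) ^ c := by
      rw [← zpow_natCast h m, ← zpow_natCast h n, ← zpow_natCast h (ℓ ^ k), ← zpow_neg, ← zpow_add,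
        ← zpow_mul, ← hc]
      congr 1
      ring
    rw [this]
    apply Subgroup.zpow_mem
    rw [← hk]
    have := N.isNormal'
    exact Subgroup.pow_index_mem N.toSubgroup h
  have hclosed : IsClosed {w : G | (h ^ m)⁻¹ * w ∈ N.toSubgroup} := by
    have hNc : IsClosed (N.toSubgroup : Set G) := Subgroup.isClosed_of_isOpen _ N.isOpen'
    exact hNc.preimage (continuous_const.mul continuous_id)
  have hmem : {w : G | (h ^ m)⁻¹ * w ∈ N.toSubgroup} ∈ l := by
    rw [hl, mem_map]
    exact mem_of_superset (preimage_mem_comap hball) fun n hn => hpow n hn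
  have key : ∀ w : G, ClusterPt w l → (h ^ m)⁻¹ * w ∈ N.toSubgroup := by
    intro w hw
    have := hw.mono (le_principal_iff.2 hmem)
    have hw' := mem_closure_iff_clusterPt.2 this
    rw [hclosed.closure_eq] at hw'
    exact hw'
  have hzy : z⁻¹ * y ∈ N.toSubgroup := by
    have := N.toSubgroup.mul_mem (N.toSubgroup.inv_mem (key z hz)) (key y hy)
    simpa [mul_assoc] using this
  exact hN hzy rfl

theorem tendsto_padicPow {ℓ : ℕ} [Fact ℓ.Prime] {G : Type u} [Group G] [TopologicalSpace G]
    [IsTopologicalGroup G] [CompactSpace G] [T2Space G] [TotallyDisconnectedSpace G] [IsProL ℓ G]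
    (h : G) (x : ℤ_[ℓ]) :
    Tendsto (fun n : ℕ => h ^ n) (comap (Nat.cast : ℕ → ℤ_[ℓ]) (𝓝 x)) (𝓝 (padicPow h x)) :=
  tendsto_nhds_limUnder (exists_tendsto_pow h x)

theorem map_padicPow {ℓ : ℕ} [Fact ℓ.Prime] {G : Type u} [Group G] [TopologicalSpace G]
    [IsTopologicalGroup G] [CompactSpace G] [T2Space G] [TotallyDisconnectedSpace G] [IsProL ℓ G]
    {H : Type v} [Group H] [TopologicalSpace H]
    [IsTopologicalGroup H] [CompactSpace H] [T2Space H] [TotallyDisconnectedSpace H] [IsProL ℓ H]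
    (φ : G →* H) (hφ : Continuous φ) (h : G) (x : ℤ_[ℓ]) :
    φ (padicPow h x) = padicPow (φ h) x := by
  refine tendsto_nhds_unique ?_ (tendsto_padicPow (φ h) x)
  have := (hφ.tendsto (padicPow h x)).comp (tendsto_padicPow h x)
  refine this.congr fun n => ?_
  simp

/-! ### The Frattini quotient -/

/-- The Frattini subgroup `Φ(G) = cl(G^ℓ · G')` of a pro-`ℓ` group: the closed subgroup generated
by the `ℓ`-th powers and the commutators. -/
def frattini (ℓ : ℕ) (G : Type u) [Group G] [TopologicalSpace G] [IsTopologicalGroup G] :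
    Subgroup G :=
  (Subgroup.closure (Set.range fun g : G => g ^ ℓ) ⊔ commutator G).topologicalClosure

theorem map_topologicalClosure_le {G : Type u} [Group G] [TopologicalSpace G]
    [IsTopologicalGroup G] {H : Type v} [Group H] [TopologicalSpace H] [IsTopologicalGroup H]
    (φ : G →* H) (hφ : Continuous φ) {S : Subgroup G} {T : Subgroup H} (h : S ≤ T.comap φ) :
    S.topologicalClosure ≤ T.topologicalClosure.comap φ :=
  Subgroup.topologicalClosure_minimal _
    (h.trans (Subgroup.comap_mono T.le_topologicalClosure))
    (T.isClosed_topologicalClosure.preimage hφ)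

theorem frattini_le_comap (ℓ : ℕ) {G : Type u} [Group G] [TopologicalSpace G]
    [IsTopologicalGroup G] {H : Type v} [Group H] [TopologicalSpace H] [IsTopologicalGroup H]
    (φ : G →* H) (hφ : Continuous φ) : frattini ℓ G ≤ (frattini ℓ H).comap φ := by
  refine map_topologicalClosure_le φ hφ (sup_le ?_ ?_)
  · rw [Subgroup.closure_le]
    rintro _ ⟨g, rfl⟩
    refine Subgroup.mem_sup_left (Subgroup.subset_closure ⟨φ g, ?_⟩)
    simp
  · rw [commutator_def, Subgroup.commutator_le]
    intro a _ b _
    refine Subgroup.mem_sup_right ?_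
    rw [map_commutatorElement, commutator_def]
    exact Subgroup.commutator_mem_commutator trivial trivial

instance frattini_normal (ℓ : ℕ) (G : Type u) [Group G] [TopologicalSpace G]
    [IsTopologicalGroup G] : (frattini ℓ G).Normal where
  conj_mem n hn g := by
    have hc : Continuous (MulAut.conj g).toMonoidHom := by
      change Continuous fun x : G => g * x * g⁻¹
      fun_prop
    exact frattini_le_comap ℓ (MulAut.conj g).toMonoidHom hc hn

/-- The homomorphism `φ_* : G/Φ(G) → H/Φ(H)` induced by `φ`. -/
def frattiniMap (ℓ : ℕ) {G : Type u} [Group G] [TopologicalSpace G]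
    [IsTopologicalGroup G] {H : Type v} [Group H] [TopologicalSpace H] [IsTopologicalGroup H]
    (φ : G →ₜ* H) : G ⧸ frattini ℓ G →* H ⧸ frattini ℓ H :=
  QuotientGroup.map _ _ φ.toMonoidHom (frattini_le_comap ℓ φ.toMonoidHom φ.continuous_toFun)

/-! ### Kummerian orientations

An orientation of a pro-`ℓ` group `G` is a continuous homomorphism `θ : G →ₜ* ℤ_[ℓ]ˣ`. -/

/-- An oriented pro-`ℓ` group is torsion-free if `ℓ ≠ 2`, or if `ℓ = 2` and the image of the
orientation is contained in `1 + 4ℤ₂`. -/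
def IsTorsionFree {ℓ : ℕ} [Fact ℓ.Prime] {G : Type u} [Group G] [TopologicalSpace G]
    (θ : G →ₜ* ℤ_[ℓ]ˣ) : Prop :=
  ℓ ≠ 2 ∨ ∀ g : G, (4 : ℤ_[ℓ]) ∣ ((θ g : ℤ_[ℓ]ˣ) : ℤ_[ℓ]) - 1

/-- The action of `G` on `ℤ_ℓ(1)/ℓ^n`: the element `g` acts on `ℤ/ℓ^n` as multiplication by
`θ(g) mod ℓ^n`. -/
noncomputable def modChar {ℓ : ℕ} [Fact ℓ.Prime] {G : Type u} [Group G] [TopologicalSpace G]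
    (θ : G →ₜ* ℤ_[ℓ]ˣ) (n : ℕ) (g : G) : ZMod (ℓ ^ n) :=
  PadicInt.toZModPow n ((θ g : ℤ_[ℓ]ˣ) : ℤ_[ℓ])

/-- Continuous 1-cocycles of `G` with values in the discrete module `ℤ_ℓ(1)/ℓ^n`. -/
noncomputable def Z1 {ℓ : ℕ} [Fact ℓ.Prime] {G : Type u} [Group G] [TopologicalSpace G]
    (θ : G →ₜ* ℤ_[ℓ]ˣ) (n : ℕ) : AddSubgroup (G → ZMod (ℓ ^ n)) where
  carrier := {c | Continuous c ∧ ∀ g h : G, c (g * h) = c g + modChar θ n g * c h}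
  zero_mem' := ⟨continuous_const, by simp⟩
  add_mem' := by
    rintro a b ⟨ha, ha'⟩ ⟨hb, hb'⟩
    refine ⟨ha.add hb, fun g h => ?_⟩
    simp only [Pi.add_apply, ha', hb']
    ring
  neg_mem' := by
    rintro a ⟨ha, ha'⟩
    refine ⟨ha.neg, fun g h => ?_⟩
    simp only [Pi.neg_apply, ha']
    ring

/-- The 1-coboundaries `g ↦ g·v - v` of `G` with values in `ℤ_ℓ(1)/ℓ^n`. -/
noncomputable def B1 {ℓ : ℕ} [Fact ℓ.Prime] {G : Type u} [Group G] [TopologicalSpace G]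
    (θ : G →ₜ* ℤ_[ℓ]ˣ) (n : ℕ) : AddSubgroup (G → ZMod (ℓ ^ n)) where
  carrier := {c | ∃ v : ZMod (ℓ ^ n), ∀ g : G, c g = modChar θ n g * v - v}
  zero_mem' := ⟨0, by simp⟩
  add_mem' := by
    rintro a b ⟨v, hv⟩ ⟨w, hw⟩
    refine ⟨v + w, fun g => ?_⟩
    simp only [Pi.add_apply, hv, hw]
    ring
  neg_mem' := by
    rintro a ⟨v, hv⟩
    refine ⟨-v, fun g => ?_⟩
    simp only [Pi.neg_apply, hv]
    ring

/-- The cohomology group `H¹(G, ℤ_ℓ(1)/ℓ^n)`: continuous 1-cocycles modulo 1-coboundaries. -/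
abbrev H1 {ℓ : ℕ} [Fact ℓ.Prime] {G : Type u} [Group G] [TopologicalSpace G]
    (θ : G →ₜ* ℤ_[ℓ]ˣ) (n : ℕ) : Type u :=
  Z1 θ n ⧸ (B1 θ n).addSubgroupOf (Z1 θ n)

/-- The reduction `ℤ_ℓ(1)/ℓ^n → ℤ_ℓ(1)/ℓ` of coefficients, for `n ≥ 1`. -/
noncomputable def coeffRed (ℓ : ℕ) (n : ℕ) (hn : 1 ≤ n) : ZMod (ℓ ^ n) →+* ZMod (ℓ ^ 1) :=
  ZMod.castHom (pow_dvd_pow ℓ hn) (ZMod (ℓ ^ 1))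

theorem coeffRed_modChar {ℓ : ℕ} [Fact ℓ.Prime] {G : Type u} [Group G] [TopologicalSpace G]
    (θ : G →ₜ* ℤ_[ℓ]ˣ) (n : ℕ) (hn : 1 ≤ n) (g : G) :
    coeffRed ℓ n hn (modChar θ n g) = modChar θ 1 g :=
  RingHom.congr_fun (PadicInt.zmod_cast_comp_toZModPow (p := ℓ) 1 n hn) _

/-- Reduction of coefficients on continuous 1-cocycles. -/
noncomputable def redZ1 {ℓ : ℕ} [Fact ℓ.Prime] {G : Type u} [Group G] [TopologicalSpace G]
    (θ : G →ₜ* ℤ_[ℓ]ˣ) (n : ℕ) (hn : 1 ≤ n) : Z1 θ n →+ Z1 θ 1 where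
  toFun c := ⟨fun g => coeffRed ℓ n hn (c.1 g),
    (continuous_of_discreteTopology (f := coeffRed ℓ n hn)).comp c.2.1, fun g h => by
      have hc : c.1 (g * h) = c.1 g + modChar θ n g * c.1 h := c.2.2 g h
      change coeffRed ℓ n hn (c.1 (g * h)) = _
      rw [hc, map_add, map_mul, coeffRed_modChar]⟩
  map_zero' := by
    ext g
    simp
  map_add' a b := by
    ext g
    simp

/-- The map `H¹(G, ℤ_ℓ(1)/ℓ^n) → H¹(G, ℤ_ℓ(1)/ℓ)` induced by reduction of coefficients. -/
noncomputable def redH1 {ℓ : ℕ} [Fact ℓ.Prime] {G : Type u} [Group G] [TopologicalSpace G]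
    (θ : G →ₜ* ℤ_[ℓ]ˣ) (n : ℕ) (hn : 1 ≤ n) : H1 θ n →+ H1 θ 1 :=
  QuotientAddGroup.map _ _ (redZ1 θ n hn) <| by
    rintro c ⟨v, hv⟩
    refine ⟨coeffRed ℓ n hn v, fun g => ?_⟩
    have hv' : c.1 g = modChar θ n g * v - v := hv g
    change coeffRed ℓ n hn (c.1 g) = _
    rw [hv', map_sub, map_mul, coeffRed_modChar]

/-- An oriented pro-`ℓ` group is Kummerian if it is torsion-free and, for every `n ≥ 1`, the map
`H¹(G, ℤ_ℓ(1)/ℓ^n) → H¹(G, ℤ_ℓ(1)/ℓ) = H¹(G, 𝔽_ℓ)` is surjective. -/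
def IsKummerian {ℓ : ℕ} [Fact ℓ.Prime] {G : Type u} [Group G] [TopologicalSpace G]
    (θ : G →ₜ* ℤ_[ℓ]ˣ) : Prop :=
  IsTorsionFree θ ∧ ∀ (n : ℕ) (hn : 1 ≤ n), Function.Surjective (redH1 θ n hn)

/-! ### The maximal `θ`-abelian quotient -/

/-- The closed subgroup `K_θ(G)` generated by the elements `h^{-θ(g)} g h g⁻¹`
with `g ∈ G` and `h ∈ ker θ`. -/
noncomputable def kSubgroup {ℓ : ℕ} [Fact ℓ.Prime] {G : Type u} [Group G] [TopologicalSpace G]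
    [IsTopologicalGroup G] (θ : G →ₜ* ℤ_[ℓ]ˣ) : Subgroup G :=
  (Subgroup.closure {x : G | ∃ g h : G, θ h = 1 ∧
    x = (padicPow h ((θ g : ℤ_[ℓ]ˣ) : ℤ_[ℓ]))⁻¹ * (g * h * g⁻¹)}).topologicalClosure

/-- The closed subgroup `I_θ(G)` generated by the elements `g ∈ ker θ` with
`g^{ℓ^k} ∈ K_θ(G)` for some `k ≥ 0`. -/
noncomputable def iSubgroup {ℓ : ℕ} [Fact ℓ.Prime] {G : Type u} [Group G] [TopologicalSpace G]
    [IsTopologicalGroup G] (θ : G →ₜ* ℤ_[ℓ]ˣ) : Subgroup G :=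
  (Subgroup.closure {g : G | θ g = 1 ∧ ∃ k : ℕ, g ^ (ℓ ^ k) ∈ kSubgroup θ}).topologicalClosure

theorem iSubgroup_le_ker {ℓ : ℕ} [Fact ℓ.Prime] {G : Type u} [Group G] [TopologicalSpace G]
    [IsTopologicalGroup G] (θ : G →ₜ* ℤ_[ℓ]ˣ) : iSubgroup θ ≤ θ.toMonoidHom.ker := by
  refine Subgroup.topologicalClosure_minimal _ ?_ ?_
  · rw [Subgroup.closure_le]
    rintro g ⟨hg, -⟩
    exact hg
  · exact isClosed_singleton.preimage θ.continuous_toFun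

section

variable {ℓ : ℕ} [Fact ℓ.Prime]
  {G : Type u} [Group G] [TopologicalSpace G] [IsTopologicalGroup G] [CompactSpace G]
  [T2Space G] [TotallyDisconnectedSpace G] [IsProL ℓ G]
  {H : Type v} [Group H] [TopologicalSpace H] [IsTopologicalGroup H] [CompactSpace H]
  [T2Space H] [TotallyDisconnectedSpace H] [IsProL ℓ H]

theorem kSubgroup_le_comap (θ : G →ₜ* ℤ_[ℓ]ˣ) (θ' : H →ₜ* ℤ_[ℓ]ˣ) (φ : G →* H)
    (hφ : Continuous φ) (hθ : ∀ g, θ' (φ g) = θ g) :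
    kSubgroup θ ≤ (kSubgroup θ').comap φ := by
  refine map_topologicalClosure_le φ hφ ?_
  rw [Subgroup.closure_le]
  rintro _ ⟨g, h, hh, rfl⟩
  refine Subgroup.subset_closure ⟨φ g, φ h, by rw [hθ, hh], ?_⟩
  rw [hθ]
  simp [map_padicPow φ hφ]

theorem iSubgroup_le_comap (θ : G →ₜ* ℤ_[ℓ]ˣ) (θ' : H →ₜ* ℤ_[ℓ]ˣ) (φ : G →* H)
    (hφ : Continuous φ) (hθ : ∀ g, θ' (φ g) = θ g) :
    iSubgroup θ ≤ (iSubgroup θ').comap φ := by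
  refine map_topologicalClosure_le φ hφ ?_
  rw [Subgroup.closure_le]
  rintro g ⟨hg, k, hk⟩
  refine Subgroup.subset_closure ⟨by rw [hθ, hg], k, ?_⟩
  rw [← map_pow]
  exact kSubgroup_le_comap θ θ' φ hφ hθ hk

instance iSubgroup_normal (θ : G →ₜ* ℤ_[ℓ]ˣ) : (iSubgroup θ).Normal where
  conj_mem n hn g := by
    have hc : Continuous (MulAut.conj g).toMonoidHom := by
      change Continuous fun x : G => g * x * g⁻¹
      fun_prop
    refine iSubgroup_le_comap θ θ (MulAut.conj g).toMonoidHom hc (fun x => ?_) hn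
    change θ (g * x * g⁻¹) = θ x
    rw [map_mul, map_mul, map_inv, mul_comm (θ g), mul_inv_cancel_right]

/-- The maximal `θ`-abelian quotient `G(θ) = G/I_θ(G)` of `(G, θ)`, with the quotient topology. -/
abbrev MaxThetaAb (θ : G →ₜ* ℤ_[ℓ]ˣ) : Type u := G ⧸ iSubgroup θ

/-- The orientation of `G(θ)` induced by `θ`. -/
noncomputable def orientationBar (θ : G →ₜ* ℤ_[ℓ]ˣ) : MaxThetaAb θ →ₜ* ℤ_[ℓ]ˣ where
  toMonoidHom := QuotientGroup.lift (iSubgroup θ) θ.toMonoidHom fun _ hx => iSubgroup_le_ker θ hx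
  continuous_toFun := θ.continuous_toFun.quotient_lift _

/-- The continuous homomorphism `φ^ab : G(θ) → H(θ')`, `g·I_θ(G) ↦ φ(g)·I_θ'(H)`, induced by a
homomorphism of oriented pro-`ℓ` groups `φ : (G, θ) → (H, θ')`. -/
noncomputable def thetaAbMap (θ : G →ₜ* ℤ_[ℓ]ˣ) (θ' : H →ₜ* ℤ_[ℓ]ˣ) (φ : G →ₜ* H)
    (hφ : θ'.comp φ = θ) : MaxThetaAb θ →ₜ* MaxThetaAb θ' where
  toMonoidHom := QuotientGroup.map (iSubgroup θ) (iSubgroup θ') φ.toMonoidHom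
    (iSubgroup_le_comap θ θ' φ.toMonoidHom φ.continuous_toFun fun g => DFunLike.congr_fun hφ g)
  continuous_toFun :=
    (QuotientGroup.continuous_mk.comp φ.continuous_toFun).quotient_lift _

/-- `φ^ab` is a homomorphism of oriented groups. -/
theorem orientationBar_comp_thetaAbMap (θ : G →ₜ* ℤ_[ℓ]ˣ) (θ' : H →ₜ* ℤ_[ℓ]ˣ) (φ : G →ₜ* H)
    (hφ : θ'.comp φ = θ) :
    (orientationBar θ').comp (thetaAbMap θ θ' φ hφ) = orientationBar θ := by
  refine ContinuousMonoidHom.ext fun x => ?_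
  obtain ⟨g, rfl⟩ := QuotientGroup.mk_surjective x
  exact DFunLike.congr_fun hφ g

end

end OrientedProL

/-! Every continuous cocycle `G → ℤ_ℓ(1)/ℓ^n` restricts to a `G`-equivariant homomorphism on
`ker θ` which kills `K_θ(G)`, and the theorem compares `I_θ(G)` with the subgroup `cocycleKer θ` of
`ker θ` on which all these cocycles vanish.

* If `(G, θ)` is Kummerian, then `I_θ(G) ≤ cocycleKer θ`
  (`IsKummerian.iSubgroup_le_cocycleKer`): cocycles lift to arbitrarily large moduli, so a common
  zero `g ^ ℓ^k` of all cocycles, with `g ∈ ker θ`, forces `g` to be one.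
* If `θ` is torsion-free, then `cocycleKer θ ≤ K_θ(G) ≤ I_θ(G)` (`cocycleKer_le_kSubgroup`). Here
  `θ(G)` is trivial or topologically generated by one element `θ(a)`, and lifting the exponent
  shows that in the latter case the closed subgroup generated by `a` is a complement of `ker θ`.
  Hence every equivariant homomorphism on `ker θ` extends to a cocycle of `G`, and the characters
  of the abelian pro-`ℓ` group `ker θ / K_θ(G)`, on which `G` acts through `θ`, separate points.
* If `φ` is injective on Frattini quotients and `(H, θ')` is Kummerian, then every cocycle of `G`
  is the pullback of a cocycle of `H` (`IsKummerian.exists_Z1_comp_eq`). Modulo `ℓ`, cocycles are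
  homomorphisms to `𝔽_ℓ` and this is duality for the Frattini quotients; the general case follows
  by successive approximation (`Z1_le_of_coeffRed_surjective`), since cocycles of `H` modulo `ℓ`
  lift to cocycles modulo `ℓ^n`.

So if `φ(g) ∈ I_θ'(H)`, then all cocycles of `H` vanish at `φ(g)`, all cocycles of `G` vanish at
`g`, and `g ∈ K_θ(G) ≤ I_θ(G)`. -/

namespace OrientedProL

universe u v

/-! ### Powers of one-units of `ℤ_ℓ` -/

section PadicPowers

variable {ℓ : ℕ} [Fact ℓ.Prime]

theorem dvd_of_norm_le {a b : ℤ_[ℓ]} (h : ‖a‖ ≤ ‖b‖) : b ∣ a := by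
  rcases ValuationRing.dvd_total b a with hba | ⟨c, rfl⟩
  · exact hba
  rcases eq_or_ne a 0 with rfl | ha
  · exact dvd_zero _
  have hc : IsUnit c := by
    rw [PadicInt.isUnit_iff]
    refine le_antisymm (PadicInt.norm_le_one c) ?_
    rw [norm_mul] at h
    exact le_of_mul_le_mul_left (by simpa using h) (norm_pos_iff.2 ha)
  exact (hc.mul_right_dvd).2 dvd_rfl

theorem norm_eq_of_dvd_sub {a b : ℤ_[ℓ]} (h : (ℓ : ℤ_[ℓ]) * b ∣ a - b) :
    ‖a‖ = ‖b‖ := by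
  obtain ⟨c, hc⟩ := h
  have ha : a = b * (1 + ℓ * c) := by linear_combination hc
  have h1 : ‖(ℓ : ℤ_[ℓ]) * c‖ < 1 := (PadicInt.norm_lt_one_iff_dvd _).2 (dvd_mul_right _ _)
  have h2 : ‖(1 : ℤ_[ℓ]) + ℓ * c‖ = 1 := by
    rw [PadicInt.norm_add_eq_max_of_ne (by rw [norm_one]; exact h1.ne'), norm_one]
    exact max_eq_left h1.le
  rw [ha, norm_mul, h2, mul_one]

theorem dvd_pow_sub_one {R : Type*} [CommRing R] {a x : R} (h : a ∣ x - 1) (n : ℕ) :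
    a ∣ x ^ n - 1 :=
  h.trans (by simpa using sub_dvd_pow_sub_pow x 1 n)

theorem dvd_geom_sum_sub {R : Type*} [CommRing R] {a x : R} (h : a ∣ x - 1) (n : ℕ) :
    a ∣ ∑ i ∈ Finset.range n, x ^ i - n := by
  have : ∑ i ∈ Finset.range n, x ^ i - n = ∑ i ∈ Finset.range n, (x ^ i - 1) := by simp
  rw [this]
  exact Finset.dvd_sum fun i _ => dvd_pow_sub_one h i

theorem norm_natCast_eq_one {n : ℕ} (hn : ¬ ℓ ∣ n) : ‖(n : ℤ_[ℓ])‖ = 1 := by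
  refine le_antisymm (PadicInt.norm_le_one _) (not_lt.1 fun h => hn ?_)
  have := (PadicInt.norm_int_lt_one_iff_dvd (p := ℓ) (n : ℤ)).1 (by simpa using h)
  exact_mod_cast this

theorem norm_pow_sub_one_of_not_dvd {x : ℤ_[ℓ]} (hx : (ℓ : ℤ_[ℓ]) ∣ x - 1) {n : ℕ}
    (hn : ¬ ℓ ∣ n) : ‖x ^ n - 1‖ = ‖x - 1‖ := by
  have h1 : ‖(n : ℤ_[ℓ])‖ = 1 := norm_natCast_eq_one hn
  have hu : IsUnit (n : ℤ_[ℓ]) := PadicInt.isUnit_iff.2 h1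
  have h2 : ‖∑ i ∈ Finset.range n, x ^ i‖ = ‖(n : ℤ_[ℓ])‖ :=
    norm_eq_of_dvd_sub ((hu.mul_right_dvd).2 (dvd_geom_sum_sub hx n))
  rw [← geom_sum_mul, norm_mul, h2, h1, one_mul]

theorem norm_pow_prime_sub_one {x : ℤ_[ℓ]} (hx : (ℓ : ℤ_[ℓ]) ∣ x - 1)
    (hx' : ℓ ≠ 2 ∨ (4 : ℤ_[ℓ]) ∣ x - 1) : ‖x ^ ℓ - 1‖ = ‖x - 1‖ * ‖(ℓ : ℤ_[ℓ])‖ := by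
  have : ‖∑ i ∈ Finset.range ℓ, x ^ i‖ = ‖(ℓ : ℤ_[ℓ])‖ := by
    refine norm_eq_of_dvd_sub ?_
    by_cases h2 : ℓ = 2
    · obtain ⟨c, hc⟩ := hx'.resolve_left (not_not.2 h2)
      subst h2
      refine ⟨c, ?_⟩
      simp only [Finset.sum_range_succ, Finset.sum_range_zero]
      push_cast
      linear_combination hc
    · obtain ⟨b, hb⟩ := hx
      have := odd_sq_dvd_geom_sum₂_sub (1 : ℤ_[ℓ]) b ((Fact.out : ℓ.Prime).odd_of_ne_two h2)
      rw [← hb] at this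
      simpa [sq] using this
  rw [← geom_sum_mul, norm_mul, this, mul_comm]

/-- Lifting the exponent over `ℤ_ℓ`. The hypothesis at `ℓ = 2` cannot be dropped:
`(-1)² - 1 = 0`. -/
theorem norm_pow_sub_one {x : ℤ_[ℓ]} (hx : (ℓ : ℤ_[ℓ]) ∣ x - 1)
    (hx' : ℓ ≠ 2 ∨ (4 : ℤ_[ℓ]) ∣ x - 1) (n : ℕ) : ‖x ^ n - 1‖ = ‖x - 1‖ * ‖(n : ℤ_[ℓ])‖ := by
  induction n using Nat.strong_induction_on generalizing x with
  | _ n ih =>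
  rcases Nat.eq_zero_or_pos n with rfl | hpos
  · simp
  by_cases hn : ℓ ∣ n
  · obtain ⟨m, rfl⟩ := hn
    have hm : m < ℓ * m :=
      lt_mul_of_one_lt_left (Nat.pos_of_mul_pos_left hpos) (Fact.out : ℓ.Prime).one_lt
    rw [pow_mul, ih m hm (dvd_pow_sub_one hx ℓ) (hx'.imp_right fun h => dvd_pow_sub_one h ℓ),
      norm_pow_prime_sub_one hx hx', Nat.cast_mul, norm_mul, mul_assoc]
  · have h1 : ‖(n : ℤ_[ℓ])‖ = 1 := norm_natCast_eq_one hn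
    rw [norm_pow_sub_one_of_not_dvd hx hn, h1, mul_one]

/-- The powers of `u` are dense in the ball of radius `‖u - 1‖` around `1`. -/
theorem exists_norm_sub_pow_le {u t : ℤ_[ℓ]} (hu : (ℓ : ℤ_[ℓ]) ∣ u - 1)
    (hu' : ℓ ≠ 2 ∨ (4 : ℤ_[ℓ]) ∣ u - 1) (ht : ‖t - 1‖ ≤ ‖u - 1‖) (m : ℕ) :
    ∃ n : ℕ, ‖t - u ^ n‖ ≤ ‖u - 1‖ * ‖((ℓ ^ m : ℕ) : ℤ_[ℓ])‖ := by
  induction m with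
  | zero => exact ⟨0, by simpa using ht⟩
  | succ m ih =>
    obtain ⟨n, hn⟩ := ih
    rw [← norm_pow_sub_one hu hu'] at hn
    obtain ⟨y, hy⟩ := dvd_of_norm_le hn
    set z := u ^ ℓ ^ m with hz
    obtain ⟨j, -, hj⟩ := PadicInt.exists_mem_range y
    rw [PadicInt.maximalIdeal_eq_span_p, Ideal.mem_span_singleton] at hj
    have hzd : (ℓ : ℤ_[ℓ]) ∣ z - 1 := dvd_pow_sub_one hu _
    -- with `j ≡ y` modulo `ℓ`, the exponent `n + ℓ ^ m * j` is one digit better than `n`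
    refine ⟨n + ℓ ^ m * j, ?_⟩
    have e : t - u ^ (n + ℓ ^ m * j) =
        (z - 1) * (y - u ^ n * ∑ i ∈ Finset.range j, z ^ i) := by
      rw [pow_add, pow_mul, ← hz]
      linear_combination hy + u ^ n * geom_sum_mul z j
    have hd : (ℓ : ℤ_[ℓ]) ∣ y - u ^ n * ∑ i ∈ Finset.range j, z ^ i := by
      have h3 := dvd_sub (dvd_sub hj (dvd_geom_sum_sub hzd j))
        ((dvd_pow_sub_one hu n).mul_right (∑ i ∈ Finset.range j, z ^ i))
      refine h3.trans (dvd_of_eq ?_)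
      ring
    obtain ⟨w, hw⟩ := hd
    rw [e, hw, norm_mul, norm_mul, hz, norm_pow_sub_one hu hu', pow_succ ℓ m,
      Nat.cast_mul, norm_mul, mul_assoc]
    gcongr
    exact mul_le_of_le_one_right (norm_nonneg _) (PadicInt.norm_le_one w)

end PadicPowers

/-! ### Congruence subgroups of an orientation -/

section Orientation

variable {ℓ : ℕ} [Fact ℓ.Prime] {G : Type u} [Group G] [TopologicalSpace G]

theorem continuous_orientation (θ : G →ₜ* ℤ_[ℓ]ˣ) :
    Continuous fun g : G => ((θ g : ℤ_[ℓ]ˣ) : ℤ_[ℓ]) :=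
  Units.continuous_val.comp θ.continuous_toFun

/-- The congruence subgroup `{g | θ(g) ≡ 1 mod ℓ^n}`. -/
noncomputable def congruenceSubgroup (θ : G →ₜ* ℤ_[ℓ]ˣ) (n : ℕ) : Subgroup G :=
  ((Units.map (PadicInt.toZModPow (p := ℓ) n).toMonoidHom).comp θ.toMonoidHom).ker

theorem mem_congruenceSubgroup_iff_modChar (θ : G →ₜ* ℤ_[ℓ]ˣ) (n : ℕ) (g : G) :
    g ∈ congruenceSubgroup θ n ↔ modChar θ n g = 1 := by
  rw [congruenceSubgroup, MonoidHom.mem_ker, Units.ext_iff]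
  rfl

theorem mem_congruenceSubgroup_iff (θ : G →ₜ* ℤ_[ℓ]ˣ) (n : ℕ) (g : G) :
    g ∈ congruenceSubgroup θ n ↔ (ℓ : ℤ_[ℓ]) ^ n ∣ ((θ g : ℤ_[ℓ]ˣ) : ℤ_[ℓ]) - 1 := by
  rw [mem_congruenceSubgroup_iff_modChar, modChar, ← Ideal.mem_span_singleton,
    ← PadicInt.ker_toZModPow, RingHom.mem_ker, map_sub, map_one, sub_eq_zero]

instance congruenceSubgroup_normal (θ : G →ₜ* ℤ_[ℓ]ˣ) (n : ℕ) : (congruenceSubgroup θ n).Normal :=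
  MonoidHom.normal_ker _

theorem isOpen_congruenceSubgroup (θ : G →ₜ* ℤ_[ℓ]ˣ) (n : ℕ) :
    IsOpen (congruenceSubgroup θ n : Set G) := by
  have hℓ : (0 : ℝ) < ℓ := Nat.cast_pos.2 (Fact.out : ℓ.Prime).pos
  have : (congruenceSubgroup θ n : Set G) = (fun g : G => ((θ g : ℤ_[ℓ]ˣ) : ℤ_[ℓ])) ⁻¹'
      Metric.closedBall 1 ((ℓ : ℝ) ^ (-(n : ℤ))) := by
    ext g
    rw [SetLike.mem_coe, mem_congruenceSubgroup_iff, Set.mem_preimage, Metric.mem_closedBall,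
      dist_eq_norm, PadicInt.norm_le_pow_iff_mem_span_pow, Ideal.mem_span_singleton]
  rw [this]
  exact (IsUltrametricDist.isOpen_closedBall _ (by positivity)).preimage (continuous_orientation θ)

/-- An orientation of a pro-`ℓ` group is trivial modulo `ℓ`, as `𝔽_ℓˣ` has order prime to `ℓ`. -/
theorem modChar_one_eq_one [IsProL ℓ G] (θ : G →ₜ* ℤ_[ℓ]ˣ) (g : G) : modChar θ 1 g = 1 := by
  rw [← mem_congruenceSubgroup_iff_modChar]
  obtain ⟨k, hk⟩ := IsProL.index_eq_pow (ℓ := ℓ) (congruenceSubgroup θ 1) inferInstance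
    (isOpen_congruenceSubgroup θ 1)
  have h : g ^ ℓ ^ k ∈ congruenceSubgroup θ 1 := hk ▸ Subgroup.pow_index_mem _ g
  rw [mem_congruenceSubgroup_iff, pow_one, ← Ideal.mem_span_singleton,
    ← PadicInt.maximalIdeal_eq_span_p, ← PadicInt.ker_toZMod, RingHom.mem_ker] at h ⊢
  rw [map_pow, Units.val_pow_eq_pow_val, map_sub, map_pow, ZMod.pow_card_pow] at h
  rw [map_sub, h]

theorem dvd_orientation_sub_one [IsProL ℓ G] (θ : G →ₜ* ℤ_[ℓ]ˣ) (g : G) :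
    (ℓ : ℤ_[ℓ]) ∣ ((θ g : ℤ_[ℓ]ˣ) : ℤ_[ℓ]) - 1 := by
  have := (mem_congruenceSubgroup_iff θ 1 g).1
    ((mem_congruenceSubgroup_iff_modChar θ 1 g).2 (modChar_one_eq_one θ g))
  rwa [pow_one] at this

theorem isClosed_ker (θ : G →ₜ* ℤ_[ℓ]ˣ) : IsClosed (θ.toMonoidHom.ker : Set G) :=
  isClosed_singleton.preimage θ.continuous_toFun

end Orientation

/-! ### A closed complement of the kernel of a torsion-free orientation -/

section Complement

variable {ℓ : ℕ} [Fact ℓ.Prime]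
  {G : Type u} [Group G] [TopologicalSpace G] [IsTopologicalGroup G] [CompactSpace G]
  [TotallyDisconnectedSpace G]

/-- In a profinite group, a point outside a closed subgroup `L` is outside `L N` for some open
normal subgroup `N`. -/
theorem exists_openNormalSubgroup_notMem_mul {L : Subgroup G} (hL : IsClosed (L : Set G)) {x : G}
    (hx : x ∉ L) : ∃ N : OpenNormalSubgroup G, ∀ a ∈ L, ∀ n ∈ N.toSubgroup, x ≠ a * n := by
  obtain ⟨N, hN⟩ := ProfiniteGrp.exist_openNormalSubgroup_sub_open_nhds_of_one
    (U := {y : G | x * y ∈ (L : Set G)ᶜ})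
    (hL.isOpen_compl.preimage (continuous_const.mul continuous_id)) (by simpa using hx)
  refine ⟨N, fun a ha n hn hxa => ?_⟩
  have : x * n⁻¹ ∉ L := hN (N.toSubgroup.inv_mem hn)
  exact this (by rwa [hxa, mul_inv_cancel_right])

/-- On the closed subgroup generated by `a`, a torsion-free orientation which is nontrivial at `a`
is injective: by lifting the exponent, a power of `a` whose orientation is `ℓ`-adically close to `1`
has an exponent `ℓ`-adically close to `0`, hence is close to `1`. -/
theorem eq_one_of_mem_closure_zpowers [T2Space G] [IsProL ℓ G] {θ : G →ₜ* ℤ_[ℓ]ˣ}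
    (hθ : IsTorsionFree θ) {a : G} (ha : θ a ≠ 1) {p : G}
    (hp : p ∈ (Subgroup.zpowers a).topologicalClosure) (hp1 : θ p = 1) : p = 1 := by
  by_contra hne
  obtain ⟨N, hN⟩ := exists_openNormalSubgroup_notMem_mul (L := (⊥ : Subgroup G))
    (by simp) (x := p) (by simpa using hne)
  obtain ⟨k, hk⟩ := IsProL.index_eq_pow (ℓ := ℓ) N.toSubgroup N.isNormal' N.isOpen'
  set u : ℤ_[ℓ] := ((θ a : ℤ_[ℓ]ˣ) : ℤ_[ℓ]) with hu
  have hu1 : u - 1 ≠ 0 := fun h => ha (Units.ext (sub_eq_zero.1 h))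
  set v := (u - 1).valuation with hv
  -- the neighbourhood `p (N ∩ {θ ≡ 1 mod ℓ ^ (v + k)})` of `p` contains a power of `a`
  have hopen : IsOpen {y : G | p⁻¹ * y ∈ (N.toSubgroup ⊓ congruenceSubgroup θ (v + k))} :=
    (N.isOpen'.inter (isOpen_congruenceSubgroup θ (v + k))).preimage
      (continuous_const.mul continuous_id)
  obtain ⟨y, hy, m, rfl⟩ := mem_closure_iff.1 hp _ hopen (by simp)
  obtain ⟨hyN, hyC⟩ : p⁻¹ * a ^ m ∈ N.toSubgroup ∧ p⁻¹ * a ^ m ∈ congruenceSubgroup θ (v + k) := hy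
  have hm : a ^ m ∈ congruenceSubgroup θ (v + k) := by
    rw [mem_congruenceSubgroup_iff] at hyC ⊢
    have h1 : θ (p⁻¹ * a ^ m) = θ (a ^ m) := by rw [map_mul, map_inv, hp1, inv_one, one_mul]
    rwa [← h1]
  obtain ⟨n, hnm⟩ := Int.eq_nat_or_neg m
  have hn : a ^ n ∈ congruenceSubgroup θ (v + k) := by
    rcases hnm with rfl | rfl <;> simpa using hm
  have hdvd : (ℓ : ℤ_[ℓ]) ^ k ∣ (n : ℤ_[ℓ]) := by
    rw [mem_congruenceSubgroup_iff, map_pow, Units.val_pow_eq_pow_val, ← hu] at hn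
    have hle : ‖(ℓ : ℤ_[ℓ]) ^ (v + k) * 1‖ ≥ ‖u ^ n - 1‖ := by
      obtain ⟨w, hw⟩ := hn
      rw [hw, norm_mul, norm_mul, norm_one]
      gcongr
      exact PadicInt.norm_le_one w
    rw [norm_pow_sub_one (dvd_orientation_sub_one θ a) (hθ.imp_right fun h => h a), mul_one,
      pow_add, norm_mul, norm_pow, PadicInt.norm_p, PadicInt.norm_eq_zpow_neg_valuation hu1,
      ← hv, zpow_neg, zpow_natCast, inv_pow] at hle
    refine dvd_of_norm_le (le_of_mul_le_mul_left hle ?_)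
    have : 0 < ℓ := (Fact.out : ℓ.Prime).pos
    positivity
  have hdvd' : ℓ ^ k ∣ n := by
    have := (PadicInt.pow_p_dvd_int_iff k (n : ℤ)).1 (by simpa using hdvd)
    exact_mod_cast this
  have hmN : a ^ m ∈ N.toSubgroup := by
    have hnN : a ^ n ∈ N.toSubgroup := by
      obtain ⟨c, rfl⟩ := hdvd'
      have := N.isNormal'
      rw [pow_mul]
      exact Subgroup.pow_mem _ (hk ▸ Subgroup.pow_index_mem N.toSubgroup a) c
    rcases hnm with rfl | rfl <;> simpa using hnN
  refine hN 1 (one_mem _) p ?_ (one_mul p).symm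
  have := N.toSubgroup.mul_mem hmN (N.toSubgroup.inv_mem hyN)
  simpa using this

/-- The kernel of a torsion-free orientation `θ` of a pro-`ℓ` group has a closed complement. It is
topologically generated by an element at which `θ` is as far from `1` as possible. -/
theorem exists_isClosed_complement [T2Space G] [IsProL ℓ G] {θ : G →ₜ* ℤ_[ℓ]ˣ}
    (hθ : IsTorsionFree θ) :
    ∃ P : Subgroup G, IsClosed (P : Set G) ∧ (∀ p ∈ P, θ p = 1 → p = 1) ∧
      ∀ x : G, ∃ p ∈ P, θ p = θ x := by
  obtain ⟨a, -, ha⟩ := isCompact_univ.exists_isMaxOn (Set.univ_nonempty (α := G))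
    (f := fun g : G => ‖((θ g : ℤ_[ℓ]ˣ) : ℤ_[ℓ]) - 1‖)
    (((continuous_orientation θ).sub continuous_const).norm).continuousOn
  have ha' : ∀ x : G, ‖((θ x : ℤ_[ℓ]ˣ) : ℤ_[ℓ]) - 1‖ ≤ ‖((θ a : ℤ_[ℓ]ˣ) : ℤ_[ℓ]) - 1‖ :=
    fun x => ha (Set.mem_univ x)
  by_cases h1 : θ a = 1
  · refine ⟨⊥, by simp, fun p hp _ => by simpa using hp, fun x => ⟨1, one_mem _, ?_⟩⟩
    have := ha' x
    rw [h1, Units.val_one, sub_self, norm_zero, norm_le_zero_iff, sub_eq_zero] at this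
    rw [map_one]
    exact (Units.ext this).symm
  · refine ⟨(Subgroup.zpowers a).topologicalClosure, Subgroup.isClosed_topologicalClosure _,
      fun p hp => eq_one_of_mem_closure_zpowers hθ h1 hp, fun x => ?_⟩
    set P := (Subgroup.zpowers a).topologicalClosure
    have hclosed : IsClosed ((fun g : G => ((θ g : ℤ_[ℓ]ˣ) : ℤ_[ℓ])) '' (P : Set G)) :=
      ((Subgroup.isClosed_topologicalClosure _).isCompact.image (continuous_orientation θ)).isClosed
    have hmem : ((θ x : ℤ_[ℓ]ˣ) : ℤ_[ℓ]) ∈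
        closure ((fun g : G => ((θ g : ℤ_[ℓ]ˣ) : ℤ_[ℓ])) '' (P : Set G)) := by
      rw [Metric.mem_closure_iff]
      intro ε hε
      have hℓ : (1 : ℝ) < ℓ := by exact_mod_cast (Fact.out : ℓ.Prime).one_lt
      obtain ⟨m, hm⟩ := exists_pow_lt_of_lt_one hε (inv_lt_one_of_one_lt₀ hℓ)
      obtain ⟨n, hn⟩ := exists_norm_sub_pow_le (dvd_orientation_sub_one θ a)
        (hθ.imp_right fun h => h a) (ha' x) m
      refine ⟨_, ⟨a ^ n, Subgroup.le_topologicalClosure _ ⟨n, by simp⟩, rfl⟩, ?_⟩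
      beta_reduce
      rw [dist_eq_norm, map_pow, Units.val_pow_eq_pow_val]
      refine (hn.trans ?_).trans_lt hm
      rw [Nat.cast_pow, norm_pow, PadicInt.norm_p]
      exact mul_le_of_le_one_left (by positivity) (PadicInt.norm_le_one _)
    rw [hclosed.closure_eq] at hmem
    obtain ⟨p, hp, hpx⟩ := hmem
    exact ⟨p, hp, Units.ext hpx⟩

end Complement

/-! ### Characters separating points -/

section Separation

instance hasEnoughRootsOfUnity_multiplicative_zmod (e : ℕ) [NeZero e] :
    HasEnoughRootsOfUnity (Multiplicative (ZMod e)) e where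
  prim := ⟨Multiplicative.ofAdd 1, by
    rw [IsPrimitiveRoot.iff_orderOf, orderOf_ofAdd_eq_addOrderOf, ZMod.addOrderOf_one]⟩
  cyc :=
    have : IsCyclic (Multiplicative (ZMod e))ˣ :=
      isCyclic_of_surjective (toUnits (G := Multiplicative (ZMod e))) toUnits.surjective
    inferInstance

/-- The characters with values in `ℤ/e` separate the points of a finite abelian quotient of
exponent dividing `e`. -/
theorem exists_hom_zmod_ne_one {M : Type*} [Group M] (U : Subgroup M) [U.FiniteIndex] (e : ℕ)
    [NeZero e] (hcomm : ∀ a b : M, b⁻¹ * (a * b * a⁻¹) ∈ U) (hexp : ∀ a : M, a ^ e ∈ U)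
    {x : M} (hx : x ∉ U) :
    ∃ f : M →* Multiplicative (ZMod e), (∀ y ∈ U, f y = 1) ∧ f x ≠ 1 := by
  have hN : U.Normal := ⟨fun b hb a => by simpa using U.mul_mem hb (hcomm a b)⟩
  let _ : CommGroup (M ⧸ U) :=
    { (inferInstance : Group (M ⧸ U)) with
      mul_comm := by
        rintro ⟨a⟩ ⟨b⟩
        refine QuotientGroup.eq.2 ?_
        simpa [mul_assoc] using hcomm a⁻¹ b }
  have hdvd : Monoid.exponent (M ⧸ U) ∣ e := Monoid.exponent_dvd_of_forall_pow_eq_one <| by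
    rintro ⟨a⟩
    exact (QuotientGroup.eq_one_iff (a ^ e)).2 (hexp a)
  have := HasEnoughRootsOfUnity.of_dvd (Multiplicative (ZMod e)) hdvd
  obtain ⟨φ, hφ⟩ := CommGroup.exists_apply_ne_one_of_hasEnoughRootsOfUnity (M ⧸ U)
    (Multiplicative (ZMod e)) (a := (x : M ⧸ U)) (fun h => hx ((QuotientGroup.eq_one_iff x).1 h))
  refine ⟨(Units.coeHom _).comp (φ.comp (QuotientGroup.mk' U)), fun y hy => ?_, fun h => hφ ?_⟩
  · simp [(QuotientGroup.eq_one_iff y).2 hy]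
  · exact Units.ext h

end Separation

/-! ### `ℓ`-adic powers and the subgroup `K_θ(G)` -/

section PadicPow

theorem mem_kSubgroup {ℓ : ℕ} [Fact ℓ.Prime] {G : Type u} [Group G] [TopologicalSpace G]
    [IsTopologicalGroup G] (θ : G →ₜ* ℤ_[ℓ]ˣ) (g : G) {h : G} (hh : θ h = 1) :
    (padicPow h ((θ g : ℤ_[ℓ]ˣ) : ℤ_[ℓ]))⁻¹ * (g * h * g⁻¹) ∈ kSubgroup θ :=
  Subgroup.le_topologicalClosure _ (Subgroup.subset_closure ⟨g, h, hh, rfl⟩)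

variable {ℓ : ℕ} [Fact ℓ.Prime]
  {G : Type u} [Group G] [TopologicalSpace G] [IsTopologicalGroup G] [CompactSpace G]
  [T2Space G] [TotallyDisconnectedSpace G] [IsProL ℓ G]

theorem padicPow_natCast (h : G) (m : ℕ) : padicPow h (m : ℤ_[ℓ]) = h ^ m := by
  have hle : pure m ≤ comap (Nat.cast : ℕ → ℤ_[ℓ]) (𝓝 (m : ℤ_[ℓ])) := by
    rw [← map_le_iff_le_comap, map_pure]
    exact pure_le_nhds _
  exact tendsto_nhds_unique ((tendsto_padicPow h (m : ℤ_[ℓ])).mono_left hle)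
    (tendsto_pure_nhds _ _)

theorem exists_pow_mem_of_mem_nhds_padicPow (h : G) (x : ℤ_[ℓ]) (n : ℕ) {V : Set G}
    (hV : V ∈ 𝓝 (padicPow h x)) :
    ∃ m : ℕ, (m : ZMod (ℓ ^ n)) = PadicInt.toZModPow n x ∧ h ^ m ∈ V := by
  have hℓ : (0 : ℝ) < ℓ := Nat.cast_pos.2 (Fact.out : ℓ.Prime).pos
  have hball : Nat.cast ⁻¹' Metric.closedBall x ((ℓ : ℝ) ^ (-(n : ℤ))) ∈
      comap (Nat.cast : ℕ → ℤ_[ℓ]) (𝓝 x) :=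
    preimage_mem_comap (Metric.closedBall_mem_nhds x (by positivity))
  obtain ⟨m, hm, hmV⟩ := (comap_natCast_neBot x).nonempty_of_mem
    (inter_mem hball (tendsto_padicPow h x hV))
  refine ⟨m, ?_, hmV⟩
  rw [Set.mem_preimage, Metric.mem_closedBall, dist_eq_norm,
    PadicInt.norm_le_pow_iff_mem_span_pow, ← PadicInt.ker_toZModPow, RingHom.mem_ker, map_sub,
    map_natCast, sub_eq_zero] at hm
  exact hm

theorem orientation_padicPow (θ : G →ₜ* ℤ_[ℓ]ˣ) {h : G} (hh : θ h = 1) (x : ℤ_[ℓ]) :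
    θ (padicPow h x) = 1 :=
  (isClosed_ker θ).mem_of_tendsto (tendsto_padicPow h x)
    (Eventually.of_forall fun n => show θ (h ^ n) = 1 by rw [map_pow, hh, one_pow])

theorem kSubgroup_le_iSubgroup (θ : G →ₜ* ℤ_[ℓ]ˣ) : kSubgroup θ ≤ iSubgroup θ := by
  refine Subgroup.topologicalClosure_minimal _ ?_ (Subgroup.isClosed_topologicalClosure _)
  rw [Subgroup.closure_le]
  rintro _ ⟨g, h, hh, rfl⟩
  refine Subgroup.le_topologicalClosure _ (Subgroup.subset_closure ⟨?_, 0, ?_⟩)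
  · rw [map_mul, map_inv, orientation_padicPow θ hh, map_mul, map_mul, hh, map_inv]
    group
  · simpa using mem_kSubgroup θ g hh

end PadicPow

/-! ### Extending homomorphisms from `ker θ` to cocycles -/

section Cocycles

open scoped Pointwise

variable {ℓ : ℕ} [Fact ℓ.Prime]
  {G : Type u} [Group G] [TopologicalSpace G] [IsTopologicalGroup G] [CompactSpace G]
  [T2Space G] [TotallyDisconnectedSpace G] [IsProL ℓ G]

/-- For a torsion-free orientation, a continuous `G`-equivariant homomorphism `F` from `ker θ` to
`ℤ_ℓ(1)/ℓ^n` extends to a cocycle: with a closed complement `P` of `ker θ`, put `c(hp) = F(h)`. -/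
theorem exists_Z1_eq_on_ker {θ : G →ₜ* ℤ_[ℓ]ˣ} (hθ : IsTorsionFree θ) {n : ℕ}
    {F : G → ZMod (ℓ ^ n)} (hF : ContinuousOn F θ.toMonoidHom.ker)
    (hmul : ∀ h k, θ h = 1 → θ k = 1 → F (h * k) = F h + F k)
    (hconj : ∀ g h, θ h = 1 → F (g * h * g⁻¹) = modChar θ n g * F h) :
    ∃ c ∈ Z1 θ n, ∀ h, θ h = 1 → c h = F h := by
  obtain ⟨P, hP, hinj, hsurj⟩ := exists_isClosed_complement hθ
  choose s hsP hs using hsurj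
  have huniq : ∀ p ∈ P, ∀ x, θ p = θ x → s x = p := fun p hp x hpx => by
    have := hinj (p⁻¹ * s x) (P.mul_mem (P.inv_mem hp) (hsP x)) (by
      rw [map_mul, map_inv, hs, hpx, inv_mul_cancel])
    exact (inv_mul_eq_one.1 this).symm
  have hker : ∀ x, θ (x * (s x)⁻¹) = 1 := fun x => by
    rw [map_mul, map_inv, hs, mul_inv_cancel]
  refine ⟨fun x => F (x * (s x)⁻¹), ⟨continuous_iff_isClosed.2 fun S hS => ?_, fun x y => ?_⟩,
    fun h hh => ?_⟩
  · have : (fun x => F (x * (s x)⁻¹)) ⁻¹' S =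
        (θ.toMonoidHom.ker ∩ F ⁻¹' S : Set G) * (P : Set G) := by
      ext x
      constructor
      · exact fun hx => ⟨x * (s x)⁻¹, ⟨hker x, hx⟩, s x, hsP x, inv_mul_cancel_right _ _⟩
      · rintro ⟨h, ⟨hh, hhS⟩, p, hp, rfl⟩
        have hh1 : θ h = 1 := hh
        have hsp : s (h * p) = p := huniq p hp _ (by rw [map_mul, hh1, one_mul])
        change F (h * p * (s (h * p))⁻¹) ∈ S
        rwa [hsp, mul_inv_cancel_right]
    rw [this]
    exact ((hF.preimage_isClosed_of_isClosed (isClosed_ker θ) hS).isCompact.mul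
      hP.isCompact).isClosed
  · have hsxy : s (x * y) = s x * s y :=
      huniq _ (P.mul_mem (hsP x) (hsP y)) _ (by rw [map_mul, map_mul, hs, hs])
    have e : x * y * (s (x * y))⁻¹ = x * (y * (s y)⁻¹) * x⁻¹ * (x * (s x)⁻¹) := by
      rw [hsxy]; group
    beta_reduce
    rw [e, hmul _ _ (by rw [map_mul, map_mul, hker, map_inv]; group) (hker x), hconj _ _ (hker y),
      add_comm]
  · have : s h = 1 := huniq 1 P.one_mem h (by rw [map_one, hh])
    beta_reduce
    rw [this, inv_one, mul_one]

/-- For a torsion-free orientation, the cocycles with values in the `ℤ_ℓ(1)/ℓ^n` separate the points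
of `ker θ` modulo `K_θ(G)`. -/
theorem exists_Z1_ne_zero {θ : G →ₜ* ℤ_[ℓ]ˣ} (hθ : IsTorsionFree θ) {x : G} (hx : θ x = 1)
    (hxK : x ∉ kSubgroup θ) : ∃ n : ℕ, ∃ c ∈ Z1 θ n, c x ≠ 0 := by
  obtain ⟨N, hN⟩ := exists_openNormalSubgroup_notMem_mul
    (Subgroup.isClosed_topologicalClosure _ : IsClosed (kSubgroup θ : Set G)) hxK
  have := N.isNormal'
  obtain ⟨n, hn⟩ := IsProL.index_eq_pow (ℓ := ℓ) N.toSubgroup N.isNormal' N.isOpen'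
  have hNfin : N.toSubgroup.FiniteIndex := ⟨by
    rw [hn]; exact pow_ne_zero _ (Fact.out : ℓ.Prime).ne_zero⟩
  have hNU : N.toSubgroup ≤ kSubgroup θ ⊔ N.toSubgroup := le_sup_right
  have hUfin : (kSubgroup θ ⊔ N.toSubgroup).FiniteIndex := Subgroup.finiteIndex_of_le hNU
  -- modulo `K_θ(G) N`, conjugation by `g` raises `h ∈ ker θ` to the power `θ(g)`
  have hact : ∀ g h, θ h = 1 → ∃ m : ℕ, (m : ZMod (ℓ ^ n)) = modChar θ n g ∧
      (h ^ m)⁻¹ * (g * h * g⁻¹) ∈ kSubgroup θ ⊔ N.toSubgroup := fun g h hh => by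
    set p := padicPow h ((θ g : ℤ_[ℓ]ˣ) : ℤ_[ℓ])
    obtain ⟨m, hm, hmN⟩ := exists_pow_mem_of_mem_nhds_padicPow h ((θ g : ℤ_[ℓ]ˣ) : ℤ_[ℓ]) n
      (V := {y | p⁻¹ * y ∈ (N : Set G)})
      ((N.isOpen'.preimage (continuous_const.mul continuous_id)).mem_nhds (by simp [p]))
    refine ⟨m, hm, ?_⟩
    have := mul_mem (inv_mem (hNU hmN)) ((le_sup_left : kSubgroup θ ≤ _) (mem_kSubgroup θ g hh))
    simpa [mul_assoc, p] using this
  obtain ⟨f, hfU, hfx⟩ := exists_hom_zmod_ne_one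
    ((kSubgroup θ ⊔ N.toSubgroup).subgroupOf θ.toMonoidHom.ker) (ℓ ^ n)
    (fun a b => by
      have ha : θ (a : G) = 1 := a.2
      have := mem_kSubgroup θ (a : G) (b.2 : θ (b : G) = 1)
      rw [ha, Units.val_one, ← Nat.cast_one, padicPow_natCast, pow_one] at this
      exact Subgroup.mem_sup_left this)
    (fun a => hNU (hn ▸ Subgroup.pow_index_mem N.toSubgroup (a : G)))
    (x := ⟨x, hx⟩)
    (fun h => by
      obtain ⟨a, ha, b, hb, hab⟩ :=
        Subgroup.mem_sup_of_normal_right.1 (Subgroup.mem_subgroupOf.1 h)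
      exact hN a ha b hb hab.symm)
  classical
  let F : G → ZMod (ℓ ^ n) := fun y => if hy : θ y = 1 then (f ⟨y, hy⟩).toAdd else 0
  have hFdef : ∀ y (hy : θ y = 1), F y = (f ⟨y, hy⟩).toAdd := fun y hy => dif_pos hy
  have hFmul : ∀ h k, θ h = 1 → θ k = 1 → F (h * k) = F h + F k := fun h k hh hk => by
    rw [hFdef h hh, hFdef k hk, hFdef (h * k) (by rw [map_mul, hh, hk, one_mul]), ← toAdd_mul]
    exact congrArg _ (map_mul f ⟨h, hh⟩ ⟨k, hk⟩)
  have hFpow : ∀ h, θ h = 1 → ∀ m : ℕ, F (h ^ m) = m * F h := fun h hh m => by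
    rw [hFdef h hh, hFdef (h ^ m) (by rw [map_pow, hh, one_pow]), ← nsmul_eq_mul, ← toAdd_pow]
    exact congrArg _ (map_pow f ⟨h, hh⟩ m)
  have hFU : ∀ y z, θ y = 1 → θ z = 1 → y⁻¹ * z ∈ kSubgroup θ ⊔ N.toSubgroup → F z = F y :=
    fun y z hy hz hyz => by
      have hyz1 : θ (y⁻¹ * z) = 1 := by rw [map_mul, map_inv, hy, hz, inv_one, one_mul]
      have h0 : F (y⁻¹ * z) = 0 := by
        rw [hFdef _ hyz1, hfU _ (Subgroup.mem_subgroupOf.2 hyz), toAdd_one]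
      have := hFmul y (y⁻¹ * z) hy hyz1
      rwa [mul_inv_cancel_left, h0, add_zero] at this
  obtain ⟨c, hc, hcF⟩ := exists_Z1_eq_on_ker hθ (F := F) (fun y hy => by
      have hopen : {z : G | y⁻¹ * z ∈ (N : Set G)} ∈ 𝓝 y :=
        (N.isOpen'.preimage (continuous_const.mul continuous_id)).mem_nhds (by simp)
      refine ContinuousWithinAt.congr_of_eventuallyEq (f := fun _ => F y)
        continuousWithinAt_const ?_ rfl
      filter_upwards [mem_nhdsWithin_of_mem_nhds hopen, self_mem_nhdsWithin] with z hz hzk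
      exact hFU y z hy hzk (hNU hz))
    hFmul (fun g h hh => by
      obtain ⟨m, hm, hmU⟩ := hact g h hh
      rw [hFU (h ^ m) _ (by rw [map_pow, hh, one_pow])
        (by rw [map_mul, map_mul, hh, map_inv]; group) hmU, hFpow h hh, hm])
  refine ⟨n, c, hc, fun h0 => hfx ?_⟩
  rw [hcF x hx, hFdef x hx] at h0
  exact toAdd_eq_zero.1 h0

end Cocycles

/-! ### The coefficient rings `ℤ/ℓ^n` -/

section Coefficients

variable {ℓ : ℕ} [Fact ℓ.Prime]

theorem coeffRed_eq_zero_iff {n : ℕ} (hn : 1 ≤ n) (x : ZMod (ℓ ^ n)) :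
    coeffRed ℓ n hn x = 0 ↔ (ℓ : ZMod (ℓ ^ n)) ∣ x := by
  have : NeZero (ℓ ^ n) := ⟨pow_ne_zero _ (Fact.out : ℓ.Prime).ne_zero⟩
  constructor
  · intro h
    rw [← ZMod.natCast_zmod_val x, map_natCast, ZMod.natCast_eq_zero_iff, pow_one] at h
    rw [← ZMod.natCast_zmod_val x]
    exact Nat.cast_dvd_cast h
  · rintro ⟨y, rfl⟩
    have h0 : ((ℓ : ℕ) : ZMod (ℓ ^ 1)) = 0 := (ZMod.natCast_eq_zero_iff _ _).2 (by simp)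
    rw [map_mul, map_natCast, h0, zero_mul]

theorem coeffRed_eq_zero_of_pow_mul {n j : ℕ} (hn : 1 ≤ n) (hj : j < n) {x : ZMod (ℓ ^ n)}
    (h : (ℓ : ZMod (ℓ ^ n)) ^ j * x = 0) : coeffRed ℓ n hn x = 0 := by
  have : NeZero (ℓ ^ n) := ⟨pow_ne_zero _ (Fact.out : ℓ.Prime).ne_zero⟩
  rw [← ZMod.natCast_zmod_val x, ← Nat.cast_pow, ← Nat.cast_mul, ZMod.natCast_eq_zero_iff] at h
  rw [← ZMod.natCast_zmod_val x, map_natCast, ZMod.natCast_eq_zero_iff]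
  refine (Nat.mul_dvd_mul_iff_left (pow_pos (Fact.out : ℓ.Prime).pos j)).1 (dvd_trans ?_ h)
  rw [← pow_add]
  exact pow_dvd_pow ℓ hj

theorem castHom_eq_zero_of_pow_mul {n N k : ℕ} (hN : n + k ≤ N) {x : ZMod (ℓ ^ N)}
    (h : (ℓ : ZMod (ℓ ^ N)) ^ k * x = 0) :
    ZMod.castHom (pow_dvd_pow ℓ ((Nat.le_add_right n k).trans hN)) (ZMod (ℓ ^ n)) x = 0 := by
  have : NeZero (ℓ ^ N) := ⟨pow_ne_zero _ (Fact.out : ℓ.Prime).ne_zero⟩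
  rw [← ZMod.natCast_zmod_val x, ← Nat.cast_pow, ← Nat.cast_mul, ZMod.natCast_eq_zero_iff] at h
  rw [← ZMod.natCast_zmod_val x, map_natCast, ZMod.natCast_eq_zero_iff]
  refine (Nat.mul_dvd_mul_iff_left (pow_pos (Fact.out : ℓ.Prime).pos k)).1 (dvd_trans ?_ h)
  rw [← pow_add]
  exact pow_dvd_pow ℓ (by omega)

end Coefficients

/-! ### Lifting cocycles to larger moduli -/

section Devissage

variable {ℓ : ℕ} [Fact ℓ.Prime] {G : Type u} [Group G] [TopologicalSpace G]

theorem map_mul_of_mem_Z1 {θ : G →ₜ* ℤ_[ℓ]ˣ} {n : ℕ} {c : G → ZMod (ℓ ^ n)} (hc : c ∈ Z1 θ n)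
    (g h : G) : c (g * h) = c g + modChar θ n g * c h :=
  hc.2 g h

theorem modChar_eq_one (θ : G →ₜ* ℤ_[ℓ]ˣ) (n : ℕ) {g : G} (hg : θ g = 1) :
    modChar θ n g = 1 := by
  rw [modChar, hg, Units.val_one, map_one]

/-- If the reductions modulo `ℓ` of the cocycles in a subgroup `S` of `Z¹(G, ℤ_ℓ(1)/ℓ^n)` fill
`Z¹(G, ℤ_ℓ(1)/ℓ)`, then `S` is everything: a cocycle divisible by `ℓ^j` can be corrected by `ℓ^j`
times an element of `S` so as to become divisible by `ℓ^(j+1)`. -/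
theorem Z1_le_of_coeffRed_surjective {θ : G →ₜ* ℤ_[ℓ]ˣ} {n : ℕ} (hn : 1 ≤ n)
    {S : AddSubgroup (G → ZMod (ℓ ^ n))} (hS : S ≤ Z1 θ n)
    (hsurj : ∀ ψ ∈ Z1 θ 1, ∃ d ∈ S, ∀ g, coeffRed ℓ n hn (d g) = ψ g) : Z1 θ n ≤ S := by
  have key : ∀ i ≤ n, ∀ c ∈ Z1 θ n, (∀ g, (ℓ : ZMod (ℓ ^ n)) ^ (n - i) ∣ c g) → c ∈ S := by
    intro i
    induction i with
    | zero =>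
      intro _ c _ hdvd
      have : c = 0 := funext fun g => by
        have h0 : (ℓ : ZMod (ℓ ^ n)) ^ n = 0 := by
          rw [← Nat.cast_pow]; exact ZMod.natCast_self _
        have := hdvd g
        rwa [Nat.sub_zero, h0, zero_dvd_iff] at this
      exact this ▸ S.zero_mem
    | succ i ih =>
      intro hi c hc hdvd
      set j := n - (i + 1) with hj
      have hji : n - i = j + 1 := by omega
      have hjn : j < n := by omega
      have hex : ∀ x : ZMod (ℓ ^ n), ∃ y,
          (ℓ : ZMod (ℓ ^ n)) ^ j ∣ x → x = (ℓ : ZMod (ℓ ^ n)) ^ j * y :=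
        fun x => by
          by_cases h : (ℓ : ZMod (ℓ ^ n)) ^ j ∣ x
          · exact ⟨h.choose, fun _ => h.choose_spec⟩
          · exact ⟨0, fun h' => (h h').elim⟩
      choose s hs using hex
      have hsc : ∀ g, c g = (ℓ : ZMod (ℓ ^ n)) ^ j * s (c g) := fun g => hs _ (hdvd g)
      obtain ⟨d, hdS, hd⟩ := hsurj (fun g => coeffRed ℓ n hn (s (c g)))
        ⟨(continuous_of_discreteTopology (f := fun x => coeffRed ℓ n hn (s x))).comp hc.1,
          fun g h => by
            rw [← sub_eq_zero, ← coeffRed_modChar θ n hn, ← map_mul, ← map_add, ← map_sub]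
            refine coeffRed_eq_zero_of_pow_mul hn hjn ?_
            linear_combination map_mul_of_mem_Z1 hc g h - hsc (g * h) + hsc g
              + modChar θ n g * hsc h⟩
      have hmem : c - (ℓ ^ j) • d ∈ S :=
        ih (by omega) _ ((Z1 θ n).sub_mem hc ((Z1 θ n).nsmul_mem (hS hdS) _)) fun g => by
          have h1 : (ℓ : ZMod (ℓ ^ n)) ∣ s (c g) - d g := by
            rw [← coeffRed_eq_zero_iff hn, map_sub, hd, sub_self]
          have h2 : (c - (ℓ ^ j) • d) g = (ℓ : ZMod (ℓ ^ n)) ^ j * (s (c g) - d g) := by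
            rw [Pi.sub_apply, Pi.smul_apply, nsmul_eq_mul, Nat.cast_pow, mul_sub, ← hsc]
          rw [h2, hji, pow_succ]
          exact mul_dvd_mul_left _ h1
      have := S.add_mem hmem (S.nsmul_mem hdS (ℓ ^ j))
      rwa [sub_add_cancel] at this
  exact fun c hc => key n le_rfl c hc fun g => by rw [Nat.sub_self, pow_zero]; exact one_dvd _

theorem castHom_modChar (θ : G →ₜ* ℤ_[ℓ]ˣ) {n N : ℕ} (h : n ≤ N) (g : G) :
    ZMod.castHom (pow_dvd_pow ℓ h) (ZMod (ℓ ^ n)) (modChar θ N g) = modChar θ n g :=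
  RingHom.congr_fun (PadicInt.zmod_cast_comp_toZModPow (p := ℓ) n N h) _

/-- Over a Kummerian group, cocycles lift along `ℤ_ℓ(1)/ℓ^n → ℤ_ℓ(1)/ℓ`, not only their classes:
the coboundaries with values in `ℤ_ℓ(1)/ℓ` vanish. -/
theorem IsKummerian.exists_coeffRed_eq [IsProL ℓ G] {θ : G →ₜ* ℤ_[ℓ]ˣ} (hθ : IsKummerian θ)
    {n : ℕ} (hn : 1 ≤ n) {ψ : G → ZMod (ℓ ^ 1)} (hψ : ψ ∈ Z1 θ 1) :
    ∃ d ∈ Z1 θ n, ∀ g, coeffRed ℓ n hn (d g) = ψ g := by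
  obtain ⟨D, hD⟩ := hθ.2 n hn (QuotientAddGroup.mk ⟨ψ, hψ⟩)
  obtain ⟨d, rfl⟩ := QuotientAddGroup.mk_surjective D
  obtain ⟨v, hv⟩ := AddSubgroup.mem_addSubgroupOf.1 (QuotientAddGroup.eq.1 hD)
  refine ⟨d.1, d.2, fun g => ?_⟩
  have h : -(coeffRed ℓ n hn (d.1 g)) + ψ g = modChar θ 1 g * v - v := hv g
  rw [modChar_one_eq_one, one_mul, sub_self, neg_add_eq_zero] at h
  exact h

theorem IsKummerian.exists_castHom_eq [IsProL ℓ G] {θ : G →ₜ* ℤ_[ℓ]ˣ} (hθ : IsKummerian θ)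
    {n N : ℕ} (hn : 1 ≤ n) (hN : n ≤ N) {c : G → ZMod (ℓ ^ n)} (hc : c ∈ Z1 θ n) :
    ∃ d ∈ Z1 θ N, ∀ g, ZMod.castHom (pow_dvd_pow ℓ hN) (ZMod (ℓ ^ n)) (d g) = c g := by
  set r := ZMod.castHom (pow_dvd_pow ℓ hN) (ZMod (ℓ ^ n)) with hr
  have := Z1_le_of_coeffRed_surjective (θ := θ) hn (S := (Z1 θ N).map (r.toAddMonoidHom.compLeft G))
    (by
      rintro _ ⟨d, hd, rfl⟩
      refine ⟨(continuous_of_discreteTopology (f := r)).comp hd.1, fun g h => ?_⟩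
      change r (d (g * h)) = r (d g) + modChar θ n g * r (d h)
      rw [map_mul_of_mem_Z1 hd, map_add, map_mul, hr, castHom_modChar θ hN])
    (fun ψ hψ => by
      obtain ⟨d, hd, hdψ⟩ := hθ.exists_coeffRed_eq (hn.trans hN) hψ
      refine ⟨_, ⟨d, hd, rfl⟩, fun g => ?_⟩
      rw [← hdψ]
      exact RingHom.congr_fun (Subsingleton.elim ((coeffRed ℓ n hn).comp r) (coeffRed ℓ N _)) (d g))
  obtain ⟨d, hd, rfl⟩ := this hc
  exact ⟨d, hd, fun _ => rfl⟩

end Devissage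

/-! ### The common kernel of all cocycles -/

section Vanishing

variable {ℓ : ℕ} [Fact ℓ.Prime] {G : Type u} [Group G] [TopologicalSpace G]

theorem pow_of_mem_Z1 {θ : G →ₜ* ℤ_[ℓ]ˣ} {n : ℕ} {c : G → ZMod (ℓ ^ n)} (hc : c ∈ Z1 θ n)
    {h : G} (hh : θ h = 1) (m : ℕ) : c (h ^ m) = m * c h := by
  induction m with
  | zero =>
    have := map_mul_of_mem_Z1 hc 1 1
    rw [modChar_eq_one θ n (map_one θ), one_mul, one_mul, left_eq_add] at this
    simpa using this
  | succ m ih =>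
    rw [pow_succ, map_mul_of_mem_Z1 hc, ih, modChar_eq_one θ n (by rw [map_pow, hh, one_pow])]
    push_cast
    ring

theorem conj_of_mem_Z1 {θ : G →ₜ* ℤ_[ℓ]ˣ} {n : ℕ} {c : G → ZMod (ℓ ^ n)} (hc : c ∈ Z1 θ n)
    (g : G) {h : G} (hh : θ h = 1) : c (g * h * g⁻¹) = modChar θ n g * c h := by
  have h1 := map_mul_of_mem_Z1 hc (g * h * g⁻¹) g
  rw [modChar_eq_one θ n (by rw [map_mul, map_mul, hh, map_inv]; group), one_mul,
    inv_mul_cancel_right, map_mul_of_mem_Z1 hc] at h1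
  linear_combination -h1

/-- The elements of `ker θ` at which all cocycles with values in the `ℤ_ℓ(1)/ℓ^n` vanish. -/
noncomputable def cocycleKer (θ : G →ₜ* ℤ_[ℓ]ˣ) : Subgroup G where
  carrier := {g | θ g = 1 ∧ ∀ n : ℕ, ∀ c ∈ Z1 θ n, c g = 0}
  one_mem' := ⟨map_one θ, fun n c hc => by simpa using pow_of_mem_Z1 hc (map_one θ) 0⟩
  mul_mem' := fun {a b} ha hb => ⟨by rw [map_mul, ha.1, hb.1, one_mul], fun n c hc => by
    rw [map_mul_of_mem_Z1 hc, ha.2 n c hc, hb.2 n c hc, mul_zero, add_zero]⟩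
  inv_mem' := fun {a} ha => ⟨by rw [map_inv, ha.1, inv_one], fun n c hc => by
    have h1 : c 1 = 0 := by simpa using pow_of_mem_Z1 hc (map_one θ) 0
    have := map_mul_of_mem_Z1 hc a a⁻¹
    rw [mul_inv_cancel, h1, ha.2 n c hc, modChar_eq_one θ n ha.1, one_mul, zero_add] at this
    exact this.symm⟩

theorem isClosed_cocycleKer (θ : G →ₜ* ℤ_[ℓ]ˣ) : IsClosed (cocycleKer θ : Set G) := by
  have : (cocycleKer θ : Set G) =
      (θ.toMonoidHom.ker : Set G) ∩ ⋂ n : ℕ, ⋂ c ∈ Z1 θ n, c ⁻¹' {0} := by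
    ext g
    simp only [Set.mem_inter_iff, Set.mem_iInter, Set.mem_preimage, Set.mem_singleton_iff]
    rfl
  rw [this]
  exact (isClosed_ker θ).inter (isClosed_iInter fun n => isClosed_biInter fun c hc =>
    isClosed_singleton.preimage hc.1)

variable [IsTopologicalGroup G] [CompactSpace G] [T2Space G] [TotallyDisconnectedSpace G]
  [IsProL ℓ G]

theorem padicPow_of_mem_Z1 {θ : G →ₜ* ℤ_[ℓ]ˣ} {n : ℕ} {c : G → ZMod (ℓ ^ n)} (hc : c ∈ Z1 θ n)
    {h : G} (hh : θ h = 1) (x : ℤ_[ℓ]) : c (padicPow h x) = PadicInt.toZModPow n x * c h := by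
  obtain ⟨m, hm, hmc⟩ := exists_pow_mem_of_mem_nhds_padicPow h x n
    (V := c ⁻¹' {c (padicPow h x)})
    (((isOpen_discrete _).preimage hc.1).mem_nhds rfl)
  rw [← hm, ← pow_of_mem_Z1 hc hh]
  exact hmc.symm

theorem kSubgroup_le_cocycleKer (θ : G →ₜ* ℤ_[ℓ]ˣ) : kSubgroup θ ≤ cocycleKer θ := by
  refine Subgroup.topologicalClosure_minimal _ ?_ (isClosed_cocycleKer θ)
  rw [Subgroup.closure_le]
  rintro _ ⟨g, h, hh, rfl⟩
  have hp := orientation_padicPow θ hh ((θ g : ℤ_[ℓ]ˣ) : ℤ_[ℓ])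
  have hconj : θ (g * h * g⁻¹) = 1 := by rw [map_mul, map_mul, hh, map_inv]; group
  refine ⟨by rw [map_mul, map_inv, hp, hconj, inv_one, one_mul], fun n c hc => ?_⟩
  have h1 := map_mul_of_mem_Z1 hc (padicPow h ((θ g : ℤ_[ℓ]ˣ) : ℤ_[ℓ]))
    ((padicPow h ((θ g : ℤ_[ℓ]ˣ) : ℤ_[ℓ]))⁻¹ * (g * h * g⁻¹))
  rw [mul_inv_cancel_left, conj_of_mem_Z1 hc g hh, modChar_eq_one θ n hp, one_mul,
    padicPow_of_mem_Z1 hc hh] at h1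
  exact left_eq_add.1 h1

/-- Over a Kummerian group all cocycles vanish on `I_θ(G)`: if `g ^ ℓ^k ∈ K_θ(G)`, a lift of the
cocycle `c` to `ℤ_ℓ(1)/ℓ^(n+k)` takes at `g` a value killed by `ℓ^k`, so that `c g = 0`. -/
theorem IsKummerian.iSubgroup_le_cocycleKer {θ : G →ₜ* ℤ_[ℓ]ˣ} (hθ : IsKummerian θ) :
    iSubgroup θ ≤ cocycleKer θ := by
  refine Subgroup.topologicalClosure_minimal _ ?_ (isClosed_cocycleKer θ)
  rw [Subgroup.closure_le]
  rintro g ⟨hg, k, hk⟩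
  refine ⟨hg, fun n c hc => ?_⟩
  rcases Nat.eq_zero_or_pos n with rfl | hn
  · have : Subsingleton (ZMod (ℓ ^ 0)) := inferInstanceAs (Subsingleton (ZMod 1))
    exact Subsingleton.elim _ _
  obtain ⟨d, hd, hdc⟩ := hθ.exists_castHom_eq hn (Nat.le_add_right n k) hc
  rw [← hdc]
  refine castHom_eq_zero_of_pow_mul le_rfl ?_
  have := (kSubgroup_le_cocycleKer θ hk).2 _ d hd
  rwa [pow_of_mem_Z1 hd hg, Nat.cast_pow] at this

/-- For a torsion-free orientation, `K_θ(G)` is the common kernel on `ker θ` of all cocycles. -/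
theorem cocycleKer_le_kSubgroup {θ : G →ₜ* ℤ_[ℓ]ˣ} (hθ : IsTorsionFree θ) :
    cocycleKer θ ≤ kSubgroup θ := by
  intro g hg
  by_contra hgK
  obtain ⟨n, c, hc, hcg⟩ := exists_Z1_ne_zero hθ hg.1 hgK
  exact hcg (hg.2 n c hc)

end Vanishing

/-! ### Pulling cocycles back along `φ` -/

section Restriction

open scoped Pointwise

variable {ℓ : ℕ} [Fact ℓ.Prime]
  {G : Type u} [Group G] [TopologicalSpace G] [IsTopologicalGroup G] [CompactSpace G]
  [IsProL ℓ G]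
  {H : Type v} [Group H] [TopologicalSpace H] [IsTopologicalGroup H] [CompactSpace H]
  [T2Space H] [TotallyDisconnectedSpace H] [IsProL ℓ H]

theorem pow_mem_frattini (ℓ : ℕ) {G : Type u} [Group G] [TopologicalSpace G]
    [IsTopologicalGroup G] (a : G) : a ^ ℓ ∈ frattini ℓ G :=
  Subgroup.le_topologicalClosure _ (Subgroup.mem_sup_left (Subgroup.subset_closure ⟨a, rfl⟩))

theorem commutator_le_frattini (ℓ : ℕ) (G : Type u) [Group G] [TopologicalSpace G]
    [IsTopologicalGroup G] : commutator G ≤ frattini ℓ G :=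
  le_sup_right.trans (Subgroup.le_topologicalClosure _)

/-- If `φ` is injective on Frattini quotients, every continuous homomorphism `G → 𝔽_ℓ` factors
through `φ`: this is Pontryagin duality for the Frattini quotients. -/
theorem exists_Z1_one_comp_eq {θ : G →ₜ* ℤ_[ℓ]ˣ} {θ' : H →ₜ* ℤ_[ℓ]ˣ} {φ : G →ₜ* H}
    (hinj : Function.Injective (frattiniMap ℓ φ)) {ψ : G → ZMod (ℓ ^ 1)} (hψ : ψ ∈ Z1 θ 1) :
    ∃ ψ' ∈ Z1 θ' 1, ∀ g, ψ' (φ g) = ψ g := by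
  have : Fact (ℓ ^ 1).Prime := ⟨by rw [pow_one]; exact Fact.out⟩
  by_cases h0 : ψ = 0
  · exact ⟨0, (Z1 θ' 1).zero_mem, fun g => by rw [h0]; rfl⟩
  obtain ⟨g₁, hg₁⟩ : ∃ g, ψ g ≠ 0 := Function.ne_iff.1 h0
  have hadd : ∀ g h, ψ (g * h) = ψ g + ψ h := fun g h => by
    rw [map_mul_of_mem_Z1 hψ, modChar_one_eq_one, one_mul]
  let χ : G →* Multiplicative (ZMod (ℓ ^ 1)) :=
    MonoidHom.mk' (fun g => Multiplicative.ofAdd (ψ g)) fun g h => by rw [hadd, ofAdd_add]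
  have hχ : ∀ g, g ∈ χ.ker ↔ ψ g = 0 := fun g => Iff.rfl
  have hχcl : IsClosed (χ.ker : Set G) := isClosed_singleton.preimage (f := ψ) (t := {0}) hψ.1
  have hfrat : frattini ℓ G ≤ χ.ker := by
    refine Subgroup.topologicalClosure_minimal _ (sup_le ?_ (Abelianization.commutator_subset_ker χ))
      hχcl
    rw [Subgroup.closure_le]
    rintro _ ⟨a, rfl⟩
    refine (map_pow χ a ℓ).trans (toAdd_eq_zero.1 ?_)
    have hz : ((ℓ : ℕ) : ZMod (ℓ ^ 1)) = 0 := (ZMod.natCast_eq_zero_iff _ _).2 (by simp)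
    rw [toAdd_pow, nsmul_eq_mul, hz, zero_mul]
  set W := χ.ker.map φ.toMonoidHom ⊔ frattini ℓ H with hW
  have hWcl : IsClosed (W : Set H) := by
    rw [hW, Subgroup.mul_normal]
    exact ((hχcl.isCompact.image φ.continuous_toFun).mul
      (Subgroup.isClosed_topologicalClosure _).isCompact).isClosed
  have hg₁W : φ g₁ ∉ W := fun h => by
    obtain ⟨_, ⟨k, hk, rfl⟩, z, hz, hkz⟩ := Subgroup.mem_sup_of_normal_right.1 h
    have hz' : φ (k⁻¹ * g₁) ∈ frattini ℓ H := by
      have hkz' : φ k * z = φ g₁ := hkz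
      rwa [map_mul, map_inv, ← hkz', inv_mul_cancel_left]
    have hmem : k⁻¹ * g₁ ∈ frattini ℓ G := (QuotientGroup.eq_one_iff _).1
      (hinj (((QuotientGroup.eq_one_iff _).2 hz').trans (map_one (frattiniMap ℓ φ)).symm))
    have := χ.ker.mul_mem hk (hfrat hmem)
    rw [mul_inv_cancel_left] at this
    exact hg₁ ((hχ g₁).1 this)
  obtain ⟨N, hN⟩ := exists_openNormalSubgroup_notMem_mul hWcl hg₁W
  have hNn := N.isNormal'
  obtain ⟨n, hn⟩ := IsProL.index_eq_pow (ℓ := ℓ) N.toSubgroup N.isNormal' N.isOpen'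
  have hNfin : N.toSubgroup.FiniteIndex := ⟨by
    rw [hn]; exact pow_ne_zero _ (Fact.out : ℓ.Prime).ne_zero⟩
  have hNU : N.toSubgroup ≤ W ⊔ N.toSubgroup := le_sup_right
  have hUfin : (W ⊔ N.toSubgroup).FiniteIndex := Subgroup.finiteIndex_of_le hNU
  have hWU : W ≤ W ⊔ N.toSubgroup := le_sup_left
  have hFU : frattini ℓ H ≤ W ⊔ N.toSubgroup := le_sup_right.trans hWU
  obtain ⟨f, hfU, hfx⟩ := exists_hom_zmod_ne_one (W ⊔ N.toSubgroup) (ℓ ^ 1)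
    (fun a b => hFU (commutator_le_frattini ℓ H (by
      have := Subgroup.commutator_mem_commutator (Subgroup.mem_top b⁻¹) (Subgroup.mem_top a)
      simpa [commutatorElement_def, commutator_def, mul_assoc] using this)))
    (fun a => by rw [pow_one]; exact hFU (pow_mem_frattini ℓ a))
    (x := φ g₁)
    (fun h => by
      obtain ⟨a, ha, b, hb, hab⟩ := Subgroup.mem_sup_of_normal_right.1 h
      exact hN a ha b hb hab.symm)
  have hfcont : Continuous fun y : H => (f y).toAdd := by
    refine continuous_iff_continuousAt.2 fun y => ?_
    have hopen : {z : H | y⁻¹ * z ∈ (N : Set H)} ∈ 𝓝 y :=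
      (N.isOpen'.preimage (continuous_const.mul continuous_id)).mem_nhds (by simp)
    refine continuousAt_const.congr (f := fun _ => (f y).toAdd) ?_
    filter_upwards [hopen] with z hz
    have := hfU _ (hNU hz)
    rw [map_mul, map_inv, inv_mul_eq_one] at this
    rw [this]
  have ha : (f (φ g₁)).toAdd ≠ 0 := fun h => hfx (toAdd_eq_zero.1 h)
  -- `f ∘ φ` kills `ker ψ`, hence is a multiple of `ψ`
  refine ⟨fun y => ψ g₁ * ((f (φ g₁)).toAdd)⁻¹ * (f y).toAdd,
    ⟨continuous_of_discreteTopology.comp hfcont, fun g h => ?_⟩, fun g => ?_⟩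
  · beta_reduce
    rw [modChar_one_eq_one, map_mul, toAdd_mul]
    ring
  · set m := (ψ g * (ψ g₁)⁻¹).val
    have hm' : (m : ZMod (ℓ ^ 1)) = ψ g * (ψ g₁)⁻¹ := ZMod.natCast_zmod_val _
    have hψm : ψ (g₁ ^ m) = ψ g := by
      have : ψ (g₁ ^ m) = m * ψ g₁ := by
        have := congrArg Multiplicative.toAdd (map_pow χ g₁ m)
        rwa [toAdd_pow, nsmul_eq_mul] at this
      rw [this, hm', inv_mul_cancel_right₀ hg₁]
    have hmem : (g₁ ^ m)⁻¹ * g ∈ χ.ker := by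
      have h1 := hadd (g₁ ^ m) ((g₁ ^ m)⁻¹ * g)
      rw [mul_inv_cancel_left, hψm] at h1
      exact (hχ _).2 (left_eq_add.1 h1)
    have hfm : f (φ g) = f (φ g₁) ^ m := by
      have := hfU _ (hWU (Subgroup.mem_sup_left ⟨_, hmem, rfl⟩))
      change f (φ ((g₁ ^ m)⁻¹ * g)) = 1 at this
      rw [map_mul, map_inv, map_mul, map_inv, inv_mul_eq_one, map_pow, map_pow] at this
      exact this.symm
    beta_reduce
    rw [hfm, toAdd_pow, nsmul_eq_mul, hm']
    field_simp

/-- If `H` is Kummerian and `φ` is injective on Frattini quotients, every cocycle of `G` is the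
pullback of a cocycle of `H`. -/
theorem IsKummerian.exists_Z1_comp_eq {θ : G →ₜ* ℤ_[ℓ]ˣ} {θ' : H →ₜ* ℤ_[ℓ]ˣ}
    (hθ' : IsKummerian θ') {φ : G →ₜ* H} (hφ : θ'.comp φ = θ)
    (hinj : Function.Injective (frattiniMap ℓ φ)) {n : ℕ} (hn : 1 ≤ n) {c : G → ZMod (ℓ ^ n)}
    (hc : c ∈ Z1 θ n) : ∃ d ∈ Z1 θ' n, ∀ g, d (φ g) = c g := by
  let pull : (H → ZMod (ℓ ^ n)) →+ (G → ZMod (ℓ ^ n)) :=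
    { toFun := fun d => d ∘ φ
      map_zero' := rfl
      map_add' := fun _ _ => rfl }
  have := Z1_le_of_coeffRed_surjective (θ := θ) hn (S := (Z1 θ' n).map pull)
    (by
      rintro _ ⟨d, hd, rfl⟩
      refine ⟨hd.1.comp φ.continuous_toFun, fun g h => ?_⟩
      change d (φ (g * h)) = d (φ g) + modChar θ n g * d (φ h)
      rw [map_mul, map_mul_of_mem_Z1 hd, ← hφ]
      rfl)
    (fun ψ hψ => by
      obtain ⟨ψ', hψ', hψφ⟩ := exists_Z1_one_comp_eq (θ' := θ') hinj hψ
      obtain ⟨d, hd, hdψ⟩ := hθ'.exists_coeffRed_eq hn hψ'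
      exact ⟨_, ⟨d, hd, rfl⟩, fun g => (hdψ (φ g)).trans (hψφ g)⟩)
  obtain ⟨d, hd, rfl⟩ := this hc
  exact ⟨d, hd, fun _ => rfl⟩

end Restriction

end OrientedProL

/-! ### Injectivity on maximal `θ`-abelian quotients -/


theorem corollary3p10 {ℓ : ℕ} [Fact ℓ.Prime]
    {G : Type*} [Group G] [TopologicalSpace G] [IsTopologicalGroup G] [CompactSpace G]
    [T2Space G] [TotallyDisconnectedSpace G] [OrientedProL.IsProL ℓ G]
    {H : Type*} [Group H] [TopologicalSpace H] [IsTopologicalGroup H] [CompactSpace H]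
    [T2Space H] [TotallyDisconnectedSpace H] [OrientedProL.IsProL ℓ H]
    (θ : G →ₜ* ℤ_[ℓ]ˣ) (θ' : H →ₜ* ℤ_[ℓ]ˣ)
    (hG : OrientedProL.IsKummerian θ) (hH : OrientedProL.IsKummerian θ')
    (φ : G →ₜ* H) (hφ : θ'.comp φ = θ)
    (hinj : Function.Injective (OrientedProL.frattiniMap ℓ φ)) :
    Function.Injective (OrientedProL.thetaAbMap θ θ' φ hφ) := by
  refine (injective_iff_map_eq_one (OrientedProL.thetaAbMap θ θ' φ hφ).toMonoidHom).2 fun x hx => ?_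
  obtain ⟨g, rfl⟩ := QuotientGroup.mk_surjective x
  have hg : φ g ∈ OrientedProL.iSubgroup θ' := (QuotientGroup.eq_one_iff (φ g)).1 hx
  have hker := hH.iSubgroup_le_cocycleKer hg
  refine (QuotientGroup.eq_one_iff g).2 (OrientedProL.kSubgroup_le_iSubgroup θ
    (OrientedProL.cocycleKer_le_kSubgroup hG.1 ⟨?_, fun n c hc => ?_⟩))
  · rw [← hφ]
    exact hker.1
  · rcases Nat.eq_zero_or_pos n with rfl | hn
    · have : Subsingleton (ZMod (ℓ ^ 0)) := inferInstanceAs (Subsingleton (ZMod 1))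
      exact Subsingleton.elim _ _
    · obtain ⟨d, hd, hdc⟩ := hH.exists_Z1_comp_eq hφ hinj hn hc
      rw [← hdc]
      exact hker.2 n d hd
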